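/- A finite poset is $(\mathbf{2+2})$-free if it has no induced subposet isomorphic to the disjoint union of two $2$-element chains. For $n\ge 1$ let $\mathcal P_n$ be the set of unlabeled $(\mathbf{2+2})$-free posets with $n$ elements, that is, of such posets up to isomorphism. For $P\in\mathcal P_n$ put $D(x)=\{y\in P: y<x\}$. The sets $D(x)$, $x\in P$, are linearly ordered by inclusion; write them as $\emptyset=D_0\subsetneq D_1\subsetneq\dots\subsetneq D_k$ and put $\operatorname{rank}(P)=k$. An element $x$ is at level $i$ if $D(x)=D_i$; $L_i$ is the set of elements at level $i$; $\operatorname{srank}(P)$ is the minimum level containing a maximal element. Removal. Let $n\ge2$, $P\in\mathcal P_n$ and $i=\operatorname{srank}(P)$. If $|L_i|>1$, remove one of the maximal elements at level $i$. If $|L_i|=1$ and $i=\operatorname{rank}(P)$, remove the unique element at level $i$. If $|L_i|=1$ and $i<\operatorname{rank}(P)$, delete all relations $x<y$ with $x\in D_{i+1}\setminus D_i$ and then remove the unique element at level $i$. The result $Q$ is a well-defined element of $\mathcal P_{n-1}$, and we write $\psi(P)=(Q,i)$. Addition. Let $n\ge2$, $Q\in\mathcal P_{n-1}$ and $0\le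 i\le 1+\operatorname{rank}(Q)$; the poset $\varphi(Q,i)\in\mathcal P_n$ is obtained from $Q$ by adding a new maximal element as follows. If $i\le\operatorname{srank}(Q)$, the strict down-set of the new element is $D_i(Q)$. If $i=1+\operatorname{rank}(Q)$, the new element is larger than all elements of $Q$. If $\operatorname{srank}(Q)<i\le\operatorname{rank}(Q)$, the strict down-set of the new element is $D_i(Q)$ and, moreover, all relations $x\le y$ are added where $x\le z$ for some maximal element $z$ of $Q$ of level less than $i$ and $y$ is an element of $Q$ of level at least $i$. For a sequence $x=(x_1,\dots,x_n)$ of nonnegative integers let $\operatorname{asc}(x)=|\{1\le j<n: x_j<x_{j+1}\}|$. The sequence $x$ is an ascent sequence of length $n$ if $x_1=0$ and $x_i\le 1+\operatorname{asc}(x_1,\dots,x_{i-1})$ for $2\le i\le n$. Define $\Psi$ recursively: $\Psi$ sends the one-element poset to $(0)$, and for $n\ge 2$ and $P\in\mathcal P_n$ with $\psi(P)=(Q,i)$ and $\Psi(Q)=(x_1,\dots,x_{n-1})$, put $\Psi(P)=(x_1,\dots,x_{n-1},i)$. **Theorem.** For every $n\ge1$ the map $\Psi$ is a bijection from $\mathcal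 P_n$ onto the set of ascent sequences of length $n$. For every $P\in\mathcal P_n$ with $\Psi(P)=x=(x_1,\dots,x_n)$ one has $\operatorname{rank}(P)=\operatorname{asc}(x)$ and $\operatorname{srank}(P)=x_n$. Moreover, for every $Q\in\mathcal P_n$ with $\Psi(Q)=(x_1,\dots,x_n)$ and every $0\le i\le 1+\operatorname{rank}(Q)$ one has $\Psi(\varphi(Q,i))=(x_1,\dots,x_n,i)$. -/

import Mathlib

namespace TwoPlusTwo

/-! ### Ascent sequences -/

/-- The number of ascents of `x`: the indices `j` such that the entry following `x j` exists
and is larger than `x j`. -/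
noncomputable def asc {n : ℕ} (x : Fin n → ℕ) : ℕ :=
  {j : Fin n | ∃ h : (j : ℕ) + 1 < n, x j < x ⟨(j : ℕ) + 1, h⟩}.ncard

/-- The initial segment formed by the entries of `x` strictly before position `i`. -/
def initSeg {n : ℕ} (x : Fin n → ℕ) (i : Fin n) : Fin (i : ℕ) → ℕ :=
  fun j => x (Fin.castLE i.isLt.le j)

/-- Ascent sequences: the first entry is `0`, and every later entry is at most one more than
the number of ascents of the entries before it. -/
def IsAscentSeq {n : ℕ} (x : Fin n → ℕ) : Prop :=
  (∀ h : 0 < n, x ⟨0, h⟩ = 0) ∧ ∀ i : Fin n, 0 < (i : ℕ) → x i ≤ 1 + asc (initSeg x i)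

/-! ### Levels of a poset

In Mathlib the strict down-set `D(x)` is `Set.Iio x`. -/

/-- No induced subposet is isomorphic to the disjoint union of two chains of two elements
(the order of a sum type in Mathlib is that of the disjoint union). -/
def IsFree (α : Type*) [PartialOrder α] : Prop :=
  IsEmpty (Fin 2 ⊕ Fin 2 ↪o α)

/-- The set `D(P)` of all strict down-sets of elements. -/
def downsets (α : Type*) [PartialOrder α] : Set (Set α) :=
  Set.range (Set.Iio : α → Set α)

/-- If `D(P) = {D₀ ⊂ D₁ ⊂ ⋯ ⊂ D_k}` then the rank of the poset is `k`. -/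
noncomputable def rank (α : Type*) [PartialOrder α] : ℕ :=
  (downsets α).ncard - 1

/-- The level of `x`, that is, the index of `D(x)` in the chain `D₀ ⊂ D₁ ⊂ ⋯ ⊂ D_k`. -/
noncomputable def level {α : Type*} [PartialOrder α] (x : α) : ℕ :=
  {S : Set α | S ∈ downsets α ∧ S ⊂ Set.Iio x}.ncard

/-- `L_i`, the set of elements at level `i`. -/
def levelSet (α : Type*) [PartialOrder α] (i : ℕ) : Set α :=
  {x : α | level x = i}

/-- `D_i`, the common strict down-set of the elements at level `i` (empty if there are none). -/
def levelDown (α : Type*) [PartialOrder α] (i : ℕ) : Set α :=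
  {y : α | ∃ z ∈ levelSet α i, y < z}

/-- The minimum level containing a maximal element. -/
noncomputable def srank (α : Type*) [PartialOrder α] : ℕ :=
  sInf {i : ℕ | ∃ x : α, IsMax x ∧ level x = i}

section basic

variable {α β : Type*} [PartialOrder α] [PartialOrder β]

theorem isFree_iff : IsFree α ↔ ∀ a b c d : α, a < b → c < d → a < d ∨ c < b := by
  constructor
  · intro h a b c d hab hcd
    by_contra hcon
    push Not at hcon
    obtain ⟨had, hcb⟩ := hcon
    have h1 : ¬ a ≤ c := fun h => had (lt_of_le_of_lt h hcd)
    have h2 : ¬ c ≤ a := fun h => hcb (lt_of_le_of_lt h hab)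
    have h3 : ¬ b ≤ d := fun h => had (lt_of_lt_of_le hab h)
    have h4 : ¬ d ≤ b := fun h => hcb (lt_of_lt_of_le hcd h)
    have h5 : ¬ a ≤ d := fun h => h.lt_or_eq.elim had (fun e => h2 (e ▸ hcd.le))
    have h6 : ¬ c ≤ b := fun h => h.lt_or_eq.elim hcb (fun e => h1 (e ▸ hab.le))
    have h7 : ¬ b ≤ c := fun h => h1 (hab.le.trans h)
    have h8 : ¬ d ≤ a := fun h => h2 (hcd.le.trans h)
    refine h.false (OrderEmbedding.ofMapLEIff (Sum.elim ![a, b] ![c, d]) ?_)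
    rintro (u | u) (v | v) <;> fin_cases u <;> fin_cases v <;>
      simp [h1, h2, h3, h4, h5, h6, h7, h8, hab.le, hcd.le, hab.not_ge, hcd.not_ge]
  · intro h
    refine ⟨fun f => ?_⟩
    have e1 : f (Sum.inl 0) < f (Sum.inl 1) := by simp
    have e2 : f (Sum.inr 0) < f (Sum.inr 1) := by simp
    rcases h _ _ _ _ e1 e2 with h | h <;> simp at h

theorem IsFree.of_orderIso (e : α ≃o β) (h : IsFree α) : IsFree β :=
  ⟨fun f => h.false (f.trans e.symm.toOrderEmbedding)⟩

theorem IsFree.iio_total (h : IsFree α) (u v : α) :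
    Set.Iio u ⊆ Set.Iio v ∨ Set.Iio v ⊆ Set.Iio u := by
  by_contra hcon
  simp only [not_or, Set.not_subset] at hcon
  obtain ⟨⟨a, ha, ha'⟩, c, hc, hc'⟩ := hcon
  rcases isFree_iff.1 h a u c v ha hc with h | h
  · exact ha' h
  · exact hc' h

theorem level_lt_of_iio [Finite α] {u v : α} (h : Set.Iio u ⊂ Set.Iio v) :
    level u < level v := by
  apply Set.ncard_lt_ncard _ (Set.toFinite _)
  refine ⟨fun S hS => ⟨hS.1, hS.2.trans h⟩, fun hsub => ?_⟩
  exact (hsub ⟨⟨u, rfl⟩, h⟩ : _ ∧ _).2.ne rfl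

theorem level_lt [Finite α] {u v : α} (h : u < v) : level u < level v :=
  level_lt_of_iio ⟨fun _ hw => lt_trans hw h, fun hs => lt_irrefl u (hs h)⟩

theorem level_le [Finite α] {u v : α} (h : u ≤ v) : level u ≤ level v := by
  rcases h.lt_or_eq with h | h
  · exact (level_lt h).le
  · rw [h]

theorem IsFree.iio_subset [Finite α] (h : IsFree α) {u v : α} (huv : level u ≤ level v) :
    Set.Iio u ⊆ Set.Iio v := by
  by_contra hcon
  have h1 := (h.iio_total u v).resolve_left hcon
  exact absurd (level_lt_of_iio ⟨h1, hcon⟩) (not_lt.2 huv)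

theorem iio_map (e : α ≃o β) (x : α) : Set.Iio (e x) = e '' Set.Iio x :=
  (e.image_Iio x).symm

theorem rank_eq (e : α ≃o β) : rank α = rank β := by
  have : downsets β = (fun S => e '' S) '' downsets α := by
    ext S
    constructor
    · rintro ⟨y, rfl⟩
      exact ⟨_, ⟨e.symm y, rfl⟩, by simp⟩
    · rintro ⟨_, ⟨x, rfl⟩, rfl⟩
      exact ⟨e x, iio_map e x⟩
  rw [rank, rank, this, Set.ncard_image_of_injective _ e.injective.image_injective]

theorem image_ssubset (e : α ≃o β) {S T : Set α} : e '' S ⊂ e '' T ↔ S ⊂ T := by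
  rw [ssubset_iff_subset_not_subset, ssubset_iff_subset_not_subset,
    Set.image_subset_image_iff e.injective, Set.image_subset_image_iff e.injective]

theorem level_eq (e : α ≃o β) (x : α) : level (e x) = level x := by
  have : {S : Set β | S ∈ downsets β ∧ S ⊂ Set.Iio (e x)} =
      (fun S => e '' S) '' {S : Set α | S ∈ downsets α ∧ S ⊂ Set.Iio x} := by
    ext S
    constructor
    · rintro ⟨⟨y, rfl⟩, hS⟩
      have h := iio_map e (e.symm y)
      rw [e.apply_symm_apply] at h
      refine ⟨_, ⟨⟨e.symm y, rfl⟩, ?_⟩, h.symm⟩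
      rw [h, iio_map e x] at hS
      exact (image_ssubset e).1 hS
    · rintro ⟨_, ⟨⟨x', rfl⟩, hS⟩, rfl⟩
      refine ⟨⟨e x', iio_map e x'⟩, ?_⟩
      rw [iio_map]
      exact (image_ssubset e).2 hS
  rw [level, level, this, Set.ncard_image_of_injective _ e.injective.image_injective]

theorem isMax_map (e : α ≃o β) (x : α) : IsMax (e x) ↔ IsMax x :=
  e.isMax_apply

theorem srank_eq (e : α ≃o β) : srank α = srank β := by
  unfold srank
  congr 1
  ext i
  constructor
  · rintro ⟨x, hx, hi⟩
    exact ⟨e x, (isMax_map e x).2 hx, by rw [level_eq, hi]⟩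
  · rintro ⟨y, hy, hi⟩
    exact ⟨e.symm y, (isMax_map e.symm y).2 hy, by rw [level_eq, hi]⟩

theorem mem_levelSet_map (e : α ≃o β) (i : ℕ) (x : α) :
    e x ∈ levelSet β i ↔ x ∈ levelSet α i := by
  simp [levelSet, level_eq]

theorem ncard_levelSet_eq (e : α ≃o β) (i : ℕ) :
    (levelSet α i).ncard = (levelSet β i).ncard := by
  have : levelSet β i = e '' levelSet α i := by
    ext y
    obtain ⟨x, rfl⟩ := e.surjective y
    rw [mem_levelSet_map, e.injective.mem_set_image]
  rw [this, Set.ncard_image_of_injective _ e.injective]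

theorem mem_levelDown_map (e : α ≃o β) (i : ℕ) (x : α) :
    e x ∈ levelDown β i ↔ x ∈ levelDown α i := by
  constructor
  · rintro ⟨z, hz, hlt⟩
    exact ⟨e.symm z, (mem_levelSet_map e.symm i z).2 hz, e.lt_symm_apply.2 hlt⟩
  · rintro ⟨z, hz, hlt⟩
    exact ⟨e z, (mem_levelSet_map e i z).2 hz, e.lt_iff_lt.2 hlt⟩

end basic

/-! ### The removal operation -/

/-- The elements that the removal operation may take out: the maximal elements at the minimum
level containing a maximal element. -/
def IsRemovable {α : Type*} [PartialOrder α] (x : α) : Prop :=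
  IsMax x ∧ level x = srank α

/-- The set of elements all of whose relations `y < z` are deleted by the removal operation.
With `i = srank`, it is `D_{i+1} \ D_i` if `L_i` has one element and `i < rank`, and it is
empty in the other two cases. -/
def removalSet (α : Type*) [PartialOrder α] : Set α :=
  {y : α | ((levelSet α (srank α)).ncard = 1 ∧ srank α < rank α) ∧
    y ∈ levelDown α (srank α + 1) \ levelDown α (srank α)}

/-- The elements that remain when `x` is removed. -/
def Removed {α : Type*} (x : α) : Type _ := {y : α // y ≠ x}

/-- The order after removal of `x`: the relations `y < z` with `y` in the removal set are
deleted, all others are kept. -/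
instance Removed.partialOrder {α : Type*} [PartialOrder α] (x : α) :
    PartialOrder (Removed x) where
  le a b := a = b ∨ (a.1 < b.1 ∧ a.1 ∉ removalSet α)
  le_refl a := Or.inl rfl
  le_trans a b c := by
    rintro (rfl | ⟨h1, h2⟩) (rfl | ⟨h3, h4⟩)
    · exact Or.inl rfl
    · exact Or.inr ⟨h3, h4⟩
    · exact Or.inr ⟨h1, h2⟩
    · exact Or.inr ⟨h1.trans h3, h2⟩
  le_antisymm a b := by
    rintro (rfl | ⟨h1, _⟩) (h | ⟨h3, _⟩)
    · rfl
    · rfl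
    · exact h.symm
    · exact absurd h3 (lt_asymm h1)

instance Removed.finite {α : Type*} [Finite α] (x : α) : Finite (Removed x) :=
  inferInstanceAs (Finite {y : α // y ≠ x})

section removal

variable {α β : Type*} [PartialOrder α] [PartialOrder β]

theorem Removed.le_def {x : α} (a b : Removed x) :
    a ≤ b ↔ a = b ∨ (a.1 < b.1 ∧ a.1 ∉ removalSet α) := Iff.rfl

theorem Removed.lt_iff {x : α} (a b : Removed x) :
    a < b ↔ a.1 < b.1 ∧ a.1 ∉ removalSet α := by
  rw [lt_iff_le_and_ne, Removed.le_def]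
  constructor
  · rintro ⟨h | h, hne⟩
    · exact absurd h hne
    · exact h
  · intro h
    exact ⟨Or.inr h, fun e => h.1.ne (congrArg Subtype.val e)⟩

theorem IsFree.removed (h : IsFree α) (x : α) : IsFree (Removed x) := by
  rw [isFree_iff] at h ⊢
  intro a b c d hab hcd
  rw [Removed.lt_iff] at *
  rcases h _ _ _ _ hab.1 hcd.1 with h | h
  · exact Or.inl ⟨h, hab.2⟩
  · exact Or.inr ((Removed.lt_iff c b).2 ⟨h, hcd.2⟩)

theorem card_removed {α : Type*} [Finite α] {n : ℕ} (h : Nat.card α = n + 1) (x : α) :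
    Nat.card (Removed x) = n := by
  classical
  have := Fintype.ofFinite α
  have : Nat.card {y : α // y ≠ x} = n := by
    rw [Nat.card_eq_fintype_card] at *
    have := Fintype.card_subtype_compl (fun y : α => y = x)
    simp at this
    simp [h]
  exact this

theorem mem_removalSet_map (e : α ≃o β) (x : α) :
    e x ∈ removalSet β ↔ x ∈ removalSet α := by
  simp only [removalSet, Set.mem_ofPred_eq, Set.mem_sdiff, mem_levelDown_map, ← srank_eq e,
    ← rank_eq e, ← ncard_levelSet_eq e]

/-- An isomorphism taking `x` to `y` restricts to what remains after the removals. -/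
theorem removed_iso (e : α ≃o β) {x : α} {y : β} (hxy : e x = y) :
    Nonempty (Removed x ≃o Removed y) := by
  subst hxy
  have hne : ∀ a : α, a ≠ x ↔ e a ≠ e x := fun a => by simp
  let f : Removed x ≃ Removed (e x) := e.toEquiv.subtypeEquiv hne
  have hf : ∀ a : Removed x, (f a).1 = e a.1 := fun _ => rfl
  refine ⟨⟨f, ?_⟩⟩
  intro a b
  rw [Removed.le_def, Removed.le_def, f.apply_eq_iff_eq, hf, hf, e.lt_iff_lt, mem_removalSet_map]

/-- Maximal elements with the same strict down-set are exchanged by an automorphism. -/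
theorem exists_swap {x y : α} (hx : IsMax x) (hy : IsMax y) (h : Set.Iio x = Set.Iio y) :
    ∃ e : α ≃o α, e x = y := by
  classical
  have hlt : ∀ a, a < x ↔ a < y := fun a => Set.ext_iff.1 h a
  have hx' : ∀ a, ¬ x < a := fun a => hx.not_lt
  have hy' : ∀ a, ¬ y < a := fun a => hy.not_lt
  refine ⟨⟨Equiv.swap x y, ?_⟩, Equiv.swap_apply_left x y⟩
  intro a b
  rw [le_iff_lt_or_eq, le_iff_lt_or_eq, Equiv.apply_eq_iff_eq]
  apply or_congr_left
  simp only [Equiv.swap_apply_def]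
  split_ifs <;> simp_all

theorem exists_removable [Finite α] [Nonempty α] : ∃ x : α, IsRemovable x := by
  obtain ⟨m, hm⟩ := Set.finite_univ.exists_maximal (Set.univ_nonempty (α := α))
  have : {i : ℕ | ∃ x : α, IsMax x ∧ level x = i}.Nonempty :=
    ⟨_, m, fun b hb => hm.2 (Set.mem_univ b) hb, rfl⟩
  exact Nat.sInf_mem this

/-- The result of the removal operation depends, up to isomorphism, neither on the choice of
the removable element nor on the representative of the isomorphism class. -/
theorem removed_iso_of_removable [Finite β] (hβ : IsFree β) (e : α ≃o β) {x : α} {y : β}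
    (hx : IsRemovable x) (hy : IsRemovable y) : Nonempty (Removed x ≃o Removed y) := by
  have hex : level (e x) = level y := by rw [level_eq, hx.2, hy.2, srank_eq e]
  obtain ⟨s, hs⟩ := exists_swap ((isMax_map e x).2 hx.1) hy.1
    (Set.Subset.antisymm (hβ.iio_subset hex.le) (hβ.iio_subset hex.ge))
  exact removed_iso (e.trans s) hs

end removal

/-! ### The addition operation -/

/-- The elements after the addition of a new element `none` at level `i`. -/
def Added (α : Type*) (_i : ℕ) : Type _ := Option α

/-- The relation `a < b` is created by the addition at level `i` if `srank < i ≤ rank`, `a` is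
below some maximal element of level less than `i`, and `b` has level at least `i`. -/
def IsCreated {α : Type*} [PartialOrder α] (i : ℕ) (a b : α) : Prop :=
  (srank α < i ∧ i ≤ rank α) ∧ (∃ z : α, IsMax z ∧ level z < i ∧ a ≤ z) ∧ i ≤ level b

/-- The order after addition. The new element `none` is maximal; its strict down-set is the set
of all old elements if `i = 1 + rank`, and `D_i` if `i ≤ rank`. -/
def Added.le {α : Type*} [PartialOrder α] (i : ℕ) : Option α → Option α → Prop
  | none, none => True
  | none, some _ => False
  | some a, none => i = 1 + rank α ∨ a ∈ levelDown α i
  | some a, some b => a ≤ b ∨ IsCreated i a b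

instance Added.partialOrder (α : Type*) [PartialOrder α] [Finite α] (i : ℕ) :
    PartialOrder (Added α i) where
  le := Added.le i
  le_refl a := by
    cases a with
    | none => trivial
    | some a => exact Or.inl le_rfl
  le_trans a b c := by
    rcases a with _ | a <;> rcases b with _ | b <;> rcases c with _ | c <;>
      simp only [Added.le] <;> try tauto
    · rintro (h1 | h1) (h2 | ⟨w, hw, h2⟩)
      · exact Or.inl h2
      · exact Or.inr ⟨w, hw, lt_of_le_of_lt h1 h2⟩
      · exact Or.inl h2
      · have h3 := level_lt h2
        have h4 := h1.2.2
        have h5 : level w = i := hw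
        omega
    · rintro (h1 | h1) (h2 | h2)
      · exact Or.inl (h1.trans h2)
      · obtain ⟨hi, ⟨z, hz, hzi, hbz⟩, hc⟩ := h2
        exact Or.inr ⟨hi, ⟨z, hz, hzi, h1.trans hbz⟩, hc⟩
      · exact Or.inr ⟨h1.1, h1.2.1, h1.2.2.trans (level_le h2)⟩
      · exact Or.inr ⟨h1.1, h1.2.1, h2.2.2⟩
  le_antisymm a b := by
    rcases a with _ | a <;> rcases b with _ | b <;> simp only [Added.le] <;> try tauto
    have key : ∀ {a b : α}, IsCreated i a b → level a < level b := by
      rintro a b ⟨_, ⟨z, _, hzi, haz⟩, hb⟩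
      have := level_le haz
      omega
    rintro (h1 | h1) (h2 | h2)
    · exact congrArg some (le_antisymm h1 h2)
    · exact absurd (level_le h1) (not_le.2 (key h2))
    · exact absurd (level_le h2) (not_le.2 (key h1))
    · exact absurd (key h1) (lt_asymm (key h2))

instance Added.finite (α : Type*) [Finite α] (i : ℕ) : Finite (Added α i) :=
  inferInstanceAs (Finite (Option α))

section addition

variable {α β : Type*} [PartialOrder α] [PartialOrder β] [Finite α] [Finite β]

theorem card_added {α : Type*} [Finite α] {n : ℕ} (h : Nat.card α = n) (i : ℕ) : Nat.card (Added α i) = n + 1 := by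
  have : Nat.card (Option α) = n + 1 := by rw [Finite.card_option, h]
  exact this

theorem Added.le_def {i : ℕ} (a b : Added α i) : a ≤ b ↔ Added.le i a b := Iff.rfl

theorem Added.none_lt {i : ℕ} (b : Added α i) : ¬ (show Added α i from none) < b := by
  intro h
  cases b with
  | none => exact lt_irrefl _ h
  | some b => exact h.le

theorem Added.some_lt_none {i : ℕ} (a : α) :
    (show Added α i from some a) < (show Added α i from none) ↔
      i = 1 + rank α ∨ a ∈ levelDown α i := by
  rw [lt_iff_le_and_ne]
  exact ⟨fun h => h.1, fun h => ⟨h, fun e => Option.some_ne_none a e⟩⟩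

theorem Added.some_lt_some {i : ℕ} (a b : α) :
    (show Added α i from some a) < (show Added α i from some b) ↔
      a < b ∨ IsCreated i a b := by
  rw [lt_iff_le_and_ne]
  constructor
  · rintro ⟨h | h, hne⟩
    · exact Or.inl (lt_of_le_of_ne h fun e => hne (congrArg some e))
    · exact Or.inr h
  · rintro (h | h)
    · exact ⟨Or.inl h.le, fun e => h.ne (Option.some_injective _ e)⟩
    · refine ⟨Or.inr h, fun e => ?_⟩
      obtain rfl : a = b := Option.some_injective _ e
      obtain ⟨_, ⟨z, _, hzi, haz⟩, hb⟩ := h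
      have := level_le haz
      omega

theorem IsFree.added (h : IsFree α) (i : ℕ) : IsFree (Added α i) := by
  have hs : ∀ {a u v : α}, level u ≤ level v → a < u → a < v :=
    fun huv ha => h.iio_subset huv ha
  have hmix : ∀ {a b c d : α}, a < b → IsCreated i c d → a < d ∨ IsCreated i c b := by
    intro a b c d hab hcd
    by_cases hb : i ≤ level b
    · exact Or.inr ⟨hcd.1, hcd.2.1, hb⟩
    · exact Or.inl (hs (by have := hcd.2.2; omega) hab)
  have htop : ∀ {a c d : α}, a ∈ levelDown α i → (c < d ∨ IsCreated i c d) →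
      a < d ∨ c ∈ levelDown α i := by
    rintro a c d ⟨w, hw, haw⟩ hcd
    have hw' : level w = i := hw
    by_cases hd : i ≤ level d
    · exact Or.inl (hs (by omega) haw)
    · rcases hcd with hcd | hcd
      · exact Or.inr ⟨w, hw, hs (by omega) hcd⟩
      · exact absurd hcd.2.2 hd
  have h' := isFree_iff.1 h
  rw [isFree_iff]
  intro a b c d hab hcd
  rcases a with _ | a
  · exact absurd hab (Added.none_lt _)
  rcases c with _ | c
  · exact absurd hcd (Added.none_lt _)
  rcases b with _ | b <;> rcases d with _ | d
  · exact Or.inl hab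
  · have h1 := (Added.some_lt_none a).1 hab
    have h2 := (Added.some_lt_some c d).1 hcd
    rcases h1 with h1 | h1
    · exact Or.inr ((Added.some_lt_none c).2 (Or.inl h1))
    · rcases htop h1 h2 with h3 | h3
      · exact Or.inl ((Added.some_lt_some a d).2 (Or.inl h3))
      · exact Or.inr ((Added.some_lt_none c).2 (Or.inr h3))
  · have h1 := (Added.some_lt_some a b).1 hab
    have h2 := (Added.some_lt_none c).1 hcd
    rcases h2 with h2 | h2
    · exact Or.inl ((Added.some_lt_none a).2 (Or.inl h2))
    · rcases htop h2 h1 with h3 | h3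
      · exact Or.inr ((Added.some_lt_some c b).2 (Or.inl h3))
      · exact Or.inl ((Added.some_lt_none a).2 (Or.inr h3))
  · have h1 := (Added.some_lt_some a b).1 hab
    have h2 := (Added.some_lt_some c d).1 hcd
    have goal : (a < d ∨ IsCreated i a d) ∨ (c < b ∨ IsCreated i c b) := by
      rcases h1 with h1 | h1 <;> rcases h2 with h2 | h2
      · rcases h' _ _ _ _ h1 h2 with h3 | h3
        · exact Or.inl (Or.inl h3)
        · exact Or.inr (Or.inl h3)
      · rcases hmix h1 h2 with h3 | h3
        · exact Or.inl (Or.inl h3)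
        · exact Or.inr (Or.inr h3)
      · rcases hmix h2 h1 with h3 | h3
        · exact Or.inr (Or.inl h3)
        · exact Or.inl (Or.inr h3)
      · exact Or.inl (Or.inr ⟨h1.1, h1.2.1, h2.2.2⟩)
    rcases goal with h3 | h3
    · exact Or.inl ((Added.some_lt_some a d).2 h3)
    · exact Or.inr ((Added.some_lt_some c b).2 h3)

theorem isCreated_map (e : α ≃o β) (i : ℕ) (a b : α) :
    IsCreated i (e a) (e b) ↔ IsCreated i a b := by
  unfold IsCreated
  rw [srank_eq e, rank_eq e, level_eq, e.surjective.exists]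
  simp only [isMax_map, level_eq, e.le_iff_le]

theorem added_iso (e : α ≃o β) (i : ℕ) : Nonempty (Added α i ≃o Added β i) := by
  let f : Added α i ≃ Added β i := Equiv.optionCongr e.toEquiv
  refine ⟨⟨f, ?_⟩⟩
  intro a b
  rw [Added.le_def, Added.le_def]
  rcases a with _ | a <;> rcases b with _ | b
  · exact Iff.rfl
  · exact Iff.rfl
  · change (i = 1 + rank β ∨ e a ∈ levelDown β i) ↔ (i = 1 + rank α ∨ a ∈ levelDown α i)
    rw [rank_eq e, mem_levelDown_map]
  · change (e a ≤ e b ∨ IsCreated i (e a) (e b)) ↔ (a ≤ b ∨ IsCreated i a b)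
    rw [e.le_iff_le, isCreated_map]

end addition

/-! ### Unlabeled posets and the map to ascent sequences -/

/-- A `(2+2)`-free poset with `n` elements. -/
structure FreePoset (n : ℕ) : Type 1 where
  carrier : Type
  [order : PartialOrder carrier]
  [finite : Finite carrier]
  card_eq : Nat.card carrier = n
  free : IsFree carrier

attribute [instance] FreePoset.order FreePoset.finite

/-- Isomorphism of posets. -/
instance FreePoset.setoid (n : ℕ) : Setoid (FreePoset n) where
  r P Q := Nonempty (P.carrier ≃o Q.carrier)
  iseqv :=
    ⟨fun _ => ⟨OrderIso.refl _⟩, fun ⟨e⟩ => ⟨e.symm⟩, fun ⟨e⟩ ⟨f⟩ => ⟨e.trans f⟩⟩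

/-- Unlabeled `(2+2)`-free posets with `n` elements: isomorphism classes. -/
def UPoset (n : ℕ) : Type 1 := Quotient (FreePoset.setoid n)

/-- The rank of an unlabeled poset. -/
noncomputable def UPoset.rank {n : ℕ} (P : UPoset n) : ℕ :=
  Quotient.lift (s := FreePoset.setoid n) (fun P : FreePoset n => TwoPlusTwo.rank P.carrier)
    (fun _ _ ⟨e⟩ => rank_eq e) P

/-- The minimum level of an unlabeled poset containing a maximal element. -/
noncomputable def UPoset.srank {n : ℕ} (P : UPoset n) : ℕ :=
  Quotient.lift (s := FreePoset.setoid n) (fun P : FreePoset n => TwoPlusTwo.srank P.carrier)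
    (fun _ _ ⟨e⟩ => srank_eq e) P

theorem FreePoset.exists_removable {n : ℕ} (P : FreePoset (n + 1)) :
    ∃ x : P.carrier, IsRemovable x := by
  have : Nonempty P.carrier := by
    apply (Nat.card_pos_iff.1 _).1
    rw [P.card_eq]
    exact Nat.succ_pos n
  exact TwoPlusTwo.exists_removable

/-- The removal of the element `x`. -/
def FreePoset.remove {n : ℕ} (P : FreePoset (n + 1)) (x : P.carrier) : FreePoset n where
  carrier := Removed x
  card_eq := card_removed P.card_eq x
  free := P.free.removed x

/-- The removal operation on unlabeled posets: one of the removable elements is removed. -/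
noncomputable def UPoset.remove {n : ℕ} (P : UPoset (n + 1)) : UPoset n :=
  Quotient.lift (s := FreePoset.setoid (n + 1))
    (fun P : FreePoset (n + 1) =>
      (Quotient.mk _ (P.remove P.exists_removable.choose) : UPoset n))
    (fun P Q ⟨e⟩ => Quotient.sound (removed_iso_of_removable Q.free e
      P.exists_removable.choose_spec Q.exists_removable.choose_spec)) P

/-- The pair formed by the poset after removal and the level of the removed element. -/
noncomputable def UPoset.psi {n : ℕ} (P : UPoset (n + 1)) : UPoset n × ℕ :=
  (P.remove, P.srank)

/-- The addition of an element at level `i` (meant for `i ≤ 1 + rank`). -/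
def FreePoset.add {n : ℕ} (Q : FreePoset n) (i : ℕ) : FreePoset (n + 1) where
  carrier := Added Q.carrier i
  card_eq := card_added Q.card_eq i
  free := Q.free.added i

/-- The addition operation on unlabeled posets. -/
def UPoset.add {n : ℕ} (Q : UPoset n) (i : ℕ) : UPoset (n + 1) :=
  Quotient.lift (s := FreePoset.setoid n) (fun Q : FreePoset n => (Quotient.mk _ (Q.add i) : UPoset (n + 1)))
    (fun _ _ ⟨e⟩ => Quotient.sound (added_iso e i)) Q

/-- The map from unlabeled `(2+2)`-free posets with `n + 1` elements to sequences of length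
`n + 1`. The one-element poset is sent to `(0)`; a larger poset `P` with `psi P = (Q, i)` is
sent to the sequence of `Q` followed by `i`. -/
noncomputable def Psi : (n : ℕ) → UPoset (n + 1) → (Fin (n + 1) → ℕ)
  | 0, _ => fun _ => 0
  | n + 1, P => Fin.snoc (α := fun _ => ℕ) (Psi n P.psi.1) P.psi.2

end TwoPlusTwo

/-! Removal and addition are mutually inverse on isomorphism classes, and addition at an admissible
level `i` has a predictable effect on two statistics: `srank` becomes `i` (`srank_added_eq`), while
`rank` grows by one exactly when `i` exceeds the old `srank` (`rank_added_eq`). Thus `srank` plays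
the role of the last entry, `rank` that of the number of ascents, and the range `i ≤ 1 + rank` is
exactly the condition on the next entry of an ascent sequence. The theorem follows by induction on
the length.

The inverse relations are `removed_added_iso_of_isRemovable` and `added_removed_iso`. Each splits
into three cases, and the cases of removal match those of addition: a level with several elements
corresponds to `i ≤ srank`, a singleton top level to `i = 1 + rank`, a singleton lower level to
`srank < i ≤ rank`. In the last case the old maximal elements of level less than `i` are pushed
below everything of level at least `i`; afterwards they form `D_{i+1} \ D_i`, which is how removal
recognizes them.

Levels and ranks of the modified posets are never counted directly: `level_rank_of_labelling` reads
them off an explicit labelling that separates strict down-sets. -/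

namespace TwoPlusTwo

/-! ### Levels, ranks and strict down-sets -/

section levels

variable {α β : Type*} [PartialOrder α] [PartialOrder β]

theorem IsFree.lt_of_lt_of_level_le [Finite α] (h : IsFree α) {a u v : α} (hau : a < u)
    (huv : level u ≤ level v) : a < v :=
  h.iio_subset huv hau

/-- Without such an element the two strict down-sets would coincide, and the level depends only on
the strict down-set. -/
theorem IsFree.exists_lt_of_level_lt [Finite α] (h : IsFree α) {u v : α}
    (huv : level u < level v) : ∃ a, a < v ∧ ¬ a < u := by
  by_contra! hcon
  have h1 := h.iio_subset huv.le
  have h2 : Set.Iio u = Set.Iio v := Set.Subset.antisymm h1 hcon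
  unfold level at huv
  rw [h2] at huv
  exact lt_irrefl _ huv

/-- A labelling of the elements by `0, …, k` that is strictly monotone for inclusion of strict
down-sets is the level function. -/
theorem level_rank_of_labelling {f : α → ℕ} {k : ℕ}
    (hle : ∀ u v a, f u ≤ f v → a < u → a < v)
    (hlt : ∀ u v, f u < f v → ∃ a, a < v ∧ ¬ a < u)
    (hk : ∀ u, f u ≤ k) (hsurj : ∀ j ≤ k, ∃ u, f u = j) :
    (∀ u, level u = f u) ∧ rank α = k := by
  have : Nonempty α := (hsurj 0 (Nat.zero_le k)).nonempty
  choose! u hu using hsurj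
  have hinj : ∀ v w, Set.Iio v = Set.Iio w → f v = f w := by
    intro v w h
    by_contra hne
    rcases lt_or_gt_of_ne hne with hl | hl
    · obtain ⟨a, ha, ha'⟩ := hlt _ _ hl
      exact ha' (h.symm.subset ha)
    · obtain ⟨a, ha, ha'⟩ := hlt _ _ hl
      exact ha' (h.subset ha)
  have heq : ∀ v, Set.Iio (u (f v)) = Set.Iio v := by
    intro v
    have := hu (f v) (hk v)
    exact Set.Subset.antisymm (fun a ha => hle _ _ a this.le ha)
      (fun a ha => hle _ _ a this.ge ha)
  -- The representatives `u j` have pairwise distinct down-sets. Taking `m = f x` counts the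
  -- down-sets strictly inside that of `x`; taking `m = k + 1` counts all of them.
  have hcard : ∀ m ≤ k + 1,
      ((fun j => Set.Iio (u j)) '' (Finset.range m : Set ℕ)).ncard = m := by
    intro m hm
    rw [Set.InjOn.ncard_image, Set.ncard_coe_finset, Finset.card_range]
    intro i hi j hj hij
    simp only [Finset.coe_range, Set.mem_Iio] at hi hj
    have := hinj _ _ hij
    rwa [hu i (by omega), hu j (by omega)] at this
  constructor
  · intro x
    have hx := hk x
    rw [level, ← hcard (f x) (by omega)]
    congr 1
    ext S
    constructor
    · rintro ⟨⟨v, rfl⟩, hS⟩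
      refine ⟨f v, ?_, heq v⟩
      simp only [Finset.coe_range, Set.mem_Iio]
      by_contra hcon
      exact hS.2 fun a ha => hle _ _ a (not_lt.1 hcon) ha
    · rintro ⟨j, hj, rfl⟩
      simp only [Finset.coe_range, Set.mem_Iio] at hj
      have hj' := hu j (by omega)
      obtain ⟨a, ha, ha'⟩ := hlt (u j) x (by omega)
      exact ⟨⟨_, rfl⟩, fun a ha => hle _ _ a (by omega) ha, fun hs => ha' (hs ha)⟩
  · have : downsets α = (fun j => Set.Iio (u j)) '' (Finset.range (k + 1) : Set ℕ) := by
      ext S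
      constructor
      · rintro ⟨v, rfl⟩
        refine ⟨f v, ?_, heq v⟩
        have := hk v
        simp only [Finset.coe_range, Set.mem_Iio]
        omega
      · rintro ⟨j, _, rfl⟩
        exact ⟨_, rfl⟩
    rw [rank, this, hcard _ le_rfl, Nat.add_sub_cancel]

theorem level_lt_ncard_downsets [Finite α] (x : α) : level x < (downsets α).ncard := by
  apply Set.ncard_lt_ncard _ (Set.toFinite _)
  exact ⟨fun S hS => hS.1, fun hsub => (hsub ⟨x, rfl⟩ : _ ∧ _).2.ne rfl⟩

theorem level_le_rank [Finite α] (x : α) : level x ≤ rank α := by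
  have := level_lt_ncard_downsets x
  unfold rank
  omega

/-- Pigeonhole: equal levels force equal strict down-sets, so the level injects the down-sets into
the natural numbers smaller than their count, and every such number is attained. -/
theorem IsFree.exists_level_eq [Finite α] [Nonempty α] (h : IsFree α) {j : ℕ}
    (hj : j ≤ rank α) : ∃ x : α, level x = j := by
  let g : Set α → ℕ := fun T => {S : Set α | S ∈ downsets α ∧ S ⊂ T}.ncard
  have hg : ∀ x : α, g (Set.Iio x) = level x := fun _ => rfl
  have hinj : Set.InjOn g (downsets α) := by
    rintro _ ⟨u, rfl⟩ _ ⟨v, rfl⟩ huv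
    rw [hg, hg] at huv
    exact Set.Subset.antisymm (h.iio_subset huv.le) (h.iio_subset huv.ge)
  have hpos : 0 < (downsets α).ncard :=
    lt_of_le_of_lt (Nat.zero_le _) (level_lt_ncard_downsets (Classical.arbitrary α))
  have himg : g '' downsets α = (Finset.range (downsets α).ncard : Set ℕ) := by
    apply Set.eq_of_subset_of_ncard_le
    · rintro _ ⟨_, ⟨u, rfl⟩, rfl⟩
      simpa [hg] using level_lt_ncard_downsets u
    · rw [hinj.ncard_image, Set.ncard_coe_finset, Finset.card_range]
    · exact Finset.finite_toSet _
  have : j ∈ g '' downsets α := by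
    rw [himg]
    simp only [Finset.coe_range, Set.mem_Iio]
    unfold rank at hj
    omega
  obtain ⟨_, ⟨u, rfl⟩, hu⟩ := this
  exact ⟨u, hu⟩

theorem IsFree.mem_levelDown_iff [Finite α] (h : IsFree α) {w : α} {i : ℕ} (hw : level w = i)
    {a : α} : a ∈ levelDown α i ↔ a < w := by
  constructor
  · rintro ⟨z, hz, haz⟩
    have hz' : level z = i := hz
    exact h.lt_of_lt_of_level_le haz (by omega)
  · exact fun ha => ⟨w, hw, ha⟩

theorem srank_le_level {x : α} (hx : IsMax x) : srank α ≤ level x :=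
  Nat.sInf_le ⟨x, hx, rfl⟩

theorem srank_le_rank [Finite α] [Nonempty α] : srank α ≤ rank α := by
  obtain ⟨x, hx⟩ := exists_removable (α := α)
  rw [← hx.2]
  exact level_le_rank x

theorem srank_eq_of_isMax {x : α} (hx : IsMax x) (h : ∀ y : α, IsMax y → level x ≤ level y) :
    srank α = level x := by
  apply le_antisymm (srank_le_level hx)
  refine le_csInf (s := {i : ℕ | ∃ x : α, IsMax x ∧ level x = i}) ⟨_, x, hx, rfl⟩ ?_
  rintro _ ⟨y, hy, rfl⟩
  exact h y hy

theorem exists_isMax_ge [Finite α] (x : α) : ∃ z, x ≤ z ∧ IsMax z := by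
  obtain ⟨z, hz, hm⟩ := Set.Finite.exists_le_maximal (s := Set.univ) Set.finite_univ
    (Set.mem_univ x)
  exact ⟨z, hz, fun b hb => hm.2 (Set.mem_univ b) hb⟩

/-- Both operations are described most simply by their strict relations, so isomorphisms are tested
on `<`. -/
theorem nonempty_orderIso_of_lt_iff (e : α ≃ β) (h : ∀ a b, e a < e b ↔ a < b) :
    Nonempty (α ≃o β) := by
  refine ⟨⟨e, ?_⟩⟩
  intro a b
  rw [le_iff_lt_or_eq, le_iff_lt_or_eq, h, e.apply_eq_iff_eq]

theorem removalSet_eq_empty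
    (h : ¬ ((levelSet α (srank α)).ncard = 1 ∧ srank α < rank α)) (y : α) :
    y ∉ removalSet α := fun hy => h hy.1

theorem exists_ne_level_eq_of_ncard_ne_one [Finite α] {x : α} {i : ℕ} (hx : level x = i)
    (h : (levelSet α i).ncard ≠ 1) : ∃ y, y ≠ x ∧ level y = i := by
  by_contra! hcon
  apply h
  rw [Set.ncard_eq_one]
  refine ⟨x, Set.eq_singleton_iff_unique_mem.2 ⟨hx, fun y hy => ?_⟩⟩
  by_contra hne
  exact hcon y hne hy

theorem not_isCreated_of_le_srank {i : ℕ} (hi : i ≤ srank α) (a b : α) : ¬ IsCreated i a b :=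
  fun h => absurd h.1.1 (not_lt.2 hi)

theorem not_isCreated_of_rank_lt {i : ℕ} (hi : rank α < i) (a b : α) : ¬ IsCreated i a b :=
  fun h => absurd h.1.2 (not_le.2 hi)

theorem IsRemovable.ne_of_lt {x : α} (hx : IsRemovable x) {a b : α} (hab : a < b) : a ≠ x := by
  rintro rfl
  exact hx.1.not_lt hab

theorem IsRemovable.eq_of_level_eq {x : α} (hx : IsRemovable x) (hc : (levelSet α (srank α)).ncard = 1)
    {y : α} (hy : level y = srank α) : y = x := by
  obtain ⟨z, hz⟩ := Set.ncard_eq_one.1 hc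
  have e1 : x ∈ levelSet α (srank α) := hx.2
  have e2 : y ∈ levelSet α (srank α) := hy
  rw [hz] at e1 e2
  exact e2.trans e1.symm

end levels

/-! ### Addition followed by removal -/

section addition

variable {α : Type*} {i : ℕ}

/-- An element of the original poset, seen in the poset after addition. -/
def Added.old (i : ℕ) (a : α) : Added α i := some a

/-- The element created by the addition. -/
def Added.new (α : Type*) (i : ℕ) : Added α i := none

theorem Added.eq_new_or_old (y : Added α i) : y = Added.new α i ∨ ∃ a, y = Added.old i a := by
  rcases y with _ | a
  · exact Or.inl rfl
  · exact Or.inr ⟨a, rfl⟩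

theorem Added.old_injective : Function.Injective (Added.old i : α → Added α i) :=
  Option.some_injective α

theorem Added.old_ne_new (a : α) : Added.old i a ≠ Added.new α i := Option.some_ne_none a

variable [PartialOrder α] [Finite α]

theorem Added.not_new_lt (y : Added α i) : ¬ Added.new α i < y := Added.none_lt y

theorem Added.isMax_new : IsMax (Added.new α i) :=
  isMax_iff_forall_not_lt.2 Added.not_new_lt

theorem Added.old_lt_new {a : α} :
    Added.old i a < Added.new α i ↔ i = 1 + rank α ∨ a ∈ levelDown α i := Added.some_lt_none a

theorem Added.old_lt_old {a b : α} :
    Added.old i a < Added.old i b ↔ a < b ∨ IsCreated i a b := Added.some_lt_some a b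

/-- If the relations between old elements that are present after the addition and survive the
removal are the original ones, then removing the new element gives back the original poset. -/
theorem removed_new_iso
    (h : ∀ a b : α, (Added.old i a < Added.old i b ∧ Added.old i a ∉ removalSet (Added α i)) ↔
      a < b) :
    Nonempty (Removed (Added.new α i) ≃o α) := by
  let g : α → Removed (Added.new α i) := fun a => ⟨Added.old i a, Added.old_ne_new a⟩
  have hg : Function.Bijective g := by
    constructor
    · intro a b hab
      exact Added.old_injective (congrArg Subtype.val hab)
    · rintro ⟨y, hy⟩
      rcases y.eq_new_or_old with rfl | ⟨a, rfl⟩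
      · exact absurd rfl hy
      · exact ⟨a, rfl⟩
  obtain ⟨e⟩ := nonempty_orderIso_of_lt_iff (Equiv.ofBijective g hg) fun a b => by
    rw [Removed.lt_iff]
    exact h a b
  exact ⟨e.symm⟩

theorem srank_added (hnew : level (Added.new α i) = i)
    (h : ∀ a : α, IsMax (Added.old i a) → i ≤ level (Added.old i a)) :
    srank (Added α i) = i := by
  rw [srank_eq_of_isMax Added.isMax_new, hnew]
  intro y hy
  rw [hnew]
  rcases y.eq_new_or_old with rfl | ⟨a, rfl⟩
  · exact hnew.ge
  · exact h a hy

/-! ### Addition at a level at most `srank` -/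

section low

variable [Nonempty α]

/-- No relation between old elements is created, and the new element has the same strict down-set as
an old element `w` of level `i`. Hence no new down-set appears. -/
theorem level_rank_added_of_le_srank (h : IsFree α) (hi : i ≤ srank α) :
    level (Added.new α i) = i ∧ (∀ a : α, level (Added.old i a) = level a) ∧
      rank (Added α i) = rank α := by
  obtain ⟨w, hw⟩ := h.exists_level_eq (hi.trans srank_le_rank)
  -- Seen from below, the new element is a twin of `w`; `p` identifies the two.
  let p : Added α i → α := fun y => Option.getD y w
  have hpn : p (Added.new α i) = w := rfl
  have hpo : ∀ a, p (Added.old i a) = a := fun _ => rfl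
  have hlt : ∀ (a : α) (y : Added α i), Added.old i a < y ↔ a < p y := by
    intro a y
    rcases y.eq_new_or_old with rfl | ⟨b, rfl⟩
    · rw [Added.old_lt_new, hpn, h.mem_levelDown_iff hw, or_iff_right]
      have := srank_le_rank (α := α)
      omega
    · rw [Added.old_lt_old, hpo, or_iff_left (not_isCreated_of_le_srank hi a b)]
  have key := level_rank_of_labelling (f := fun y => level (p y)) (k := rank α) ?_ ?_ ?_ ?_
  · exact ⟨(key.1 _).trans hw, fun a => key.1 _, key.2⟩
  · intro u v a huv ha
    rcases a.eq_new_or_old with rfl | ⟨a, rfl⟩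
    · exact absurd ha (Added.not_new_lt u)
    · exact (hlt _ _).2 (h.lt_of_lt_of_level_le ((hlt _ _).1 ha) huv)
  · intro u v huv
    obtain ⟨a, ha, ha'⟩ := h.exists_lt_of_level_lt huv
    exact ⟨Added.old i a, (hlt _ _).2 ha, fun hh => ha' ((hlt _ _).1 hh)⟩
  · exact fun u => level_le_rank _
  · intro j hj
    obtain ⟨a, ha⟩ := h.exists_level_eq hj
    exact ⟨Added.old i a, ha⟩

theorem srank_added_of_le_srank (h : IsFree α) (hi : i ≤ srank α) : srank (Added α i) = i := by
  obtain ⟨h1, h2, -⟩ := level_rank_added_of_le_srank h hi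
  refine srank_added h1 fun a ha => ?_
  rw [h2]
  refine hi.trans (srank_le_level (isMax_iff_forall_not_lt.2 fun b hb => ?_))
  exact ha.not_lt (Added.old_lt_old.2 (Or.inl hb))

/-- The new element shares level `i` with an old one, so the removal deletes no relation. -/
theorem removed_added_iso_of_le_srank (h : IsFree α) (hi : i ≤ srank α) :
    Nonempty (Removed (Added.new α i) ≃o α) := by
  obtain ⟨h1, h2, -⟩ := level_rank_added_of_le_srank h hi
  obtain ⟨w, hw⟩ := h.exists_level_eq (hi.trans srank_le_rank)
  refine removed_new_iso fun a b => ?_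
  rw [Added.old_lt_old, or_iff_left (not_isCreated_of_le_srank hi a b), and_iff_left]
  refine removalSet_eq_empty (fun hc => ?_) _
  rw [srank_added_of_le_srank h hi] at hc
  obtain ⟨z, hz⟩ := Set.ncard_eq_one.1 hc.1
  have e1 : Added.new α i ∈ levelSet (Added α i) i := h1
  have e2 : Added.old i w ∈ levelSet (Added α i) i := (h2 w).trans hw
  rw [hz] at e1 e2
  exact Added.old_ne_new w (e2.trans e1.symm)

end low

/-! ### Addition of a greatest element -/

section top

variable [Nonempty α]

/-- The new element contributes one further down-set, the whole old poset, at the top of the chain.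
-/
theorem level_rank_added_top (h : IsFree α) :
    level (Added.new α (1 + rank α)) = 1 + rank α ∧
      (∀ a : α, level (Added.old (1 + rank α) a) = level a) ∧
      rank (Added α (1 + rank α)) = 1 + rank α := by
  let f : Added α (1 + rank α) → ℕ := fun y => Option.elim y (1 + rank α) level
  have hfn : f (Added.new α _) = 1 + rank α := rfl
  have hfo : ∀ a, f (Added.old _ a) = level a := fun _ => rfl
  have hn : ∀ a : α, Added.old (1 + rank α) a < Added.new α _ :=
    fun a => Added.old_lt_new.2 (Or.inl rfl)
  have ho : ∀ {a b : α}, Added.old (1 + rank α) a < Added.old _ b ↔ a < b := by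
    intro a b
    rw [Added.old_lt_old, or_iff_left (not_isCreated_of_rank_lt (by omega) a b)]
  have key := level_rank_of_labelling (f := f) (k := 1 + rank α) ?_ ?_ ?_ ?_
  · exact ⟨key.1 _, fun a => key.1 _, key.2⟩
  · intro u v a huv ha
    rcases a.eq_new_or_old with rfl | ⟨a, rfl⟩
    · exact absurd ha (Added.not_new_lt u)
    rcases v.eq_new_or_old with rfl | ⟨v, rfl⟩
    · exact hn a
    rcases u.eq_new_or_old with rfl | ⟨u, rfl⟩
    · have := level_le_rank v
      rw [hfn, hfo] at huv
      omega
    · exact ho.2 (h.lt_of_lt_of_level_le (ho.1 ha) huv)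
  · intro u v huv
    rcases u.eq_new_or_old with rfl | ⟨u, rfl⟩
    · rcases v.eq_new_or_old with rfl | ⟨v, rfl⟩
      · exact absurd huv (lt_irrefl _)
      · have := level_le_rank v
        rw [hfn, hfo] at huv
        omega
    · rcases v.eq_new_or_old with rfl | ⟨v, rfl⟩
      · exact ⟨_, hn u, lt_irrefl _⟩
      · obtain ⟨a, ha, ha'⟩ := h.exists_lt_of_level_lt huv
        exact ⟨_, ho.2 ha, fun hh => ha' (ho.1 hh)⟩
  · intro u
    rcases u.eq_new_or_old with rfl | ⟨u, rfl⟩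
    · exact hfn.le
    · have := level_le_rank u
      rw [hfo]
      omega
  · intro j hj
    rcases hj.eq_or_lt with rfl | hj
    · exact ⟨_, hfn⟩
    · obtain ⟨a, ha⟩ := h.exists_level_eq (j := j) (by omega)
      exact ⟨Added.old _ a, ha⟩

theorem srank_added_top (h : IsFree α) : srank (Added α (1 + rank α)) = 1 + rank α := by
  obtain ⟨h1, -, -⟩ := level_rank_added_top h
  exact srank_added h1 fun a ha => absurd (Added.old_lt_new.2 (Or.inl rfl)) ha.not_lt

theorem removed_added_iso_top (h : IsFree α) :
    Nonempty (Removed (Added.new α (1 + rank α)) ≃o α) := by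
  refine removed_new_iso fun a b => ?_
  rw [Added.old_lt_old, or_iff_left (not_isCreated_of_rank_lt (by omega) a b), and_iff_left]
  refine removalSet_eq_empty (fun hc => ?_) _
  rw [srank_added_top h, (level_rank_added_top h).2.2] at hc
  exact lt_irrefl _ hc.2

end top

/-! ### Addition at a level above `srank` and at most `rank` -/

section middle

/-- If `a` lies strictly below a maximal `z` of level less than `i`, freeness already puts `a` below
every element of level at least `i`. So only relations starting at the maximal elements themselves
are really new. -/
theorem old_lt_old_of_middle (h : IsFree α) (hs : srank α < i) (hr : i ≤ rank α)
    {a b : α} : Added.old i a < Added.old i b ↔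
    a < b ∨ (i ≤ level b ∧ IsMax a ∧ level a < i) := by
  rw [Added.old_lt_old]
  constructor
  · rintro (hab | ⟨-, ⟨z, hz, hzi, haz⟩, hb⟩)
    · exact Or.inl hab
    · rcases haz.lt_or_eq with haz | rfl
      · exact Or.inl (h.lt_of_lt_of_level_le haz (by omega))
      · exact Or.inr ⟨hb, hz, hzi⟩
  · rintro (hab | ⟨hb, ha, hai⟩)
    · exact Or.inl hab
    · exact Or.inr ⟨⟨hs, hr⟩, ⟨a, ha, hai, le_rfl⟩, hb⟩

variable [Nonempty α]

/-- The new element takes over `D_i`, while the old elements of level at least `i` gain the maximal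
elements of lower level. Their down-sets become strictly larger than `D_i`, so their levels move up
by one. -/
theorem level_rank_added_of_middle (h : IsFree α) (hs : srank α < i) (hr : i ≤ rank α) :
    level (Added.new α i) = i ∧
      (∀ a : α, level (Added.old i a) = if level a < i then level a else level a + 1) ∧
      rank (Added α i) = 1 + rank α := by
  obtain ⟨w, hw⟩ := h.exists_level_eq hr
  -- `m` is maximal of level `srank < i`. It will separate the new element from the old ones that
  -- move up.
  obtain ⟨m, hm, hm'⟩ := exists_removable (α := α)
  -- The shift skips the value `i`, which is reserved for the new element.
  let s : ℕ → ℕ := fun l => if l < i then l else l + 1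
  let f : Added α i → ℕ := fun y => Option.elim y i fun a => s (level a)
  have hfn : f (Added.new α _) = i := rfl
  have hfo : ∀ a, f (Added.old _ a) = s (level a) := fun _ => rfl
  have hn : ∀ {a : α}, Added.old i a < Added.new α _ ↔ a < w := by
    intro a
    rw [Added.old_lt_new, h.mem_levelDown_iff hw, or_iff_right (by omega)]
  have ho : ∀ {a b : α}, Added.old i a < Added.old i b ↔
      a < b ∨ (i ≤ level b ∧ IsMax a ∧ level a < i) := old_lt_old_of_middle h hs hr
  have key := level_rank_of_labelling (f := f) (k := 1 + rank α) ?_ ?_ ?_ ?_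
  · exact ⟨key.1 _, fun a => key.1 _, key.2⟩
  · intro u v a huv ha
    rcases a.eq_new_or_old with rfl | ⟨a, rfl⟩
    · exact absurd ha (Added.not_new_lt u)
    rcases u.eq_new_or_old with rfl | ⟨u, rfl⟩ <;> rcases v.eq_new_or_old with rfl | ⟨v, rfl⟩
    · exact ha
    · rw [hfn, hfo] at huv
      have : i ≤ level v := by grind
      exact ho.2 (Or.inl (h.lt_of_lt_of_level_le (hn.1 ha) (by omega)))
    · rw [hfn, hfo] at huv
      have hu : level u < i := by grind
      rcases ho.1 ha with ha | ha
      · exact hn.2 (h.lt_of_lt_of_level_le ha (by omega))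
      · omega
    · rw [hfo, hfo] at huv
      have huv' : level u ≤ level v := by grind
      rcases ho.1 ha with ha | ha
      · exact ho.2 (Or.inl (h.lt_of_lt_of_level_le ha huv'))
      · exact ho.2 (Or.inr ⟨ha.1.trans huv', ha.2⟩)
  · intro u v huv
    rcases u.eq_new_or_old with rfl | ⟨u, rfl⟩ <;> rcases v.eq_new_or_old with rfl | ⟨v, rfl⟩
    · exact absurd huv (lt_irrefl _)
    · rw [hfn, hfo] at huv
      have : i ≤ level v := by grind
      exact ⟨Added.old i m, ho.2 (Or.inr ⟨this, hm, by omega⟩), fun hh => hm.not_lt (hn.1 hh)⟩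
    · rw [hfn, hfo] at huv
      have hu : level u < i := by grind
      obtain ⟨a, ha, ha'⟩ := h.exists_lt_of_level_lt (u := u) (v := w) (by omega)
      refine ⟨_, hn.2 ha, fun hh => ?_⟩
      rcases ho.1 hh with hh | hh
      · exact ha' hh
      · omega
    · rw [hfo, hfo] at huv
      have huv' : level u < level v := by grind
      -- An old separating element still works: lying below `v`, it is not maximal, so no relation
      -- to `u` was created for it.
      obtain ⟨a, ha, ha'⟩ := h.exists_lt_of_level_lt huv'
      refine ⟨_, ho.2 (Or.inl ha), fun hh => ?_⟩
      rcases ho.1 hh with hh | hh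
      · exact ha' hh
      · exact hh.2.1.not_lt ha
  · intro u
    rcases u.eq_new_or_old with rfl | ⟨u, rfl⟩
    · rw [hfn]
      omega
    · have := level_le_rank u
      rw [hfo]
      grind
  · intro j hj
    rcases lt_trichotomy j i with hj' | rfl | hj'
    · obtain ⟨a, ha⟩ := h.exists_level_eq (j := j) (by omega)
      refine ⟨Added.old _ a, ?_⟩
      rw [hfo]
      grind
    · exact ⟨_, hfn⟩
    · obtain ⟨a, ha⟩ := h.exists_level_eq (j := j - 1) (by omega)
      refine ⟨Added.old _ a, ?_⟩
      rw [hfo]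
      grind

/-- Every old maximal element of level less than `i` now lies below `w`, so it is no longer maximal.
-/
theorem srank_added_of_middle (h : IsFree α) (hs : srank α < i) (hr : i ≤ rank α) :
    srank (Added α i) = i := by
  obtain ⟨h1, h2, -⟩ := level_rank_added_of_middle h hs hr
  obtain ⟨w, hw⟩ := h.exists_level_eq hr
  refine srank_added h1 fun a ha => ?_
  have ho := @old_lt_old_of_middle _ _ _ _ h hs hr
  rw [h2]
  by_contra hcon
  have hai : level a < i := by grind
  have ham : IsMax a := isMax_iff_forall_not_lt.2 fun b hb => ha.not_lt (ho.2 (Or.inl hb))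
  exact ha.not_lt (ho.2 (Or.inr ⟨hw.ge, ham, hai⟩))

theorem removed_added_iso_of_middle (h : IsFree α) (hs : srank α < i) (hr : i ≤ rank α) :
    Nonempty (Removed (Added.new α i) ≃o α) := by
  obtain ⟨h1, h2, h3⟩ := level_rank_added_of_middle h hs hr
  obtain ⟨w, hw⟩ := h.exists_level_eq hr
  have hs' := srank_added_of_middle h hs hr
  have ho := @old_lt_old_of_middle _ _ _ _ h hs hr
  have hfree := h.added i
  have hw' : level (Added.old i w) = i + 1 := by rw [h2]; grind
  have hone : (levelSet (Added α i) i).ncard = 1 := by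
    rw [Set.ncard_eq_one]
    refine ⟨Added.new α i, Set.eq_singleton_iff_unique_mem.2 ⟨h1, fun y hy => ?_⟩⟩
    rcases y.eq_new_or_old with rfl | ⟨a, rfl⟩
    · rfl
    · have hy' : level (Added.old i a) = i := hy
      rw [h2] at hy'
      grind
  -- In the new poset `D_{i+1}` is the down-set of `w`, which moved up by one, and `D_i` is that of
  -- the new element. Their difference is exactly the set of sources of the created relations.
  have hrem : ∀ a : α, Added.old i a ∈ removalSet (Added α i) ↔ IsMax a ∧ level a < i := by
    intro a
    have : Added.old i a ∈ removalSet (Added α i) ↔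
        Added.old i a < Added.old i w ∧ ¬ Added.old i a < Added.new α i := by
      unfold removalSet
      rw [hs', h3]
      simp only [Set.mem_ofPred_eq, Set.mem_sdiff, hfree.mem_levelDown_iff hw',
        hfree.mem_levelDown_iff h1]
      exact and_iff_right ⟨hone, by omega⟩
    rw [this, ho, Added.old_lt_new, h.mem_levelDown_iff hw]
    constructor
    · rintro ⟨ha | ha, ha'⟩
      · exact absurd (Or.inr ha) ha'
      · exact ha.2
    · intro ha
      refine ⟨Or.inr ⟨hw.ge, ha⟩, ?_⟩
      rintro (hh | hh)
      · omega
      · exact ha.1.not_lt hh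
  refine removed_new_iso fun a b => ?_
  rw [ho, hrem]
  constructor
  · rintro ⟨hab | hab, hn⟩
    · exact hab
    · exact absurd hab.2 hn
  · exact fun hab => ⟨Or.inl hab, fun ha => ha.1.not_lt hab⟩

end middle

variable [Nonempty α]

theorem srank_added_eq (h : IsFree α) (hi : i ≤ 1 + rank α) : srank (Added α i) = i := by
  rcases le_or_gt i (srank α) with hs | hs
  · exact srank_added_of_le_srank h hs
  rcases le_or_gt i (rank α) with hr | hr
  · exact srank_added_of_middle h hs hr
  obtain rfl : i = 1 + rank α := by omega
  exact srank_added_top h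

/-- The increment is the indicator of an ascent once `srank` is read as the last entry. -/
theorem rank_added_eq (h : IsFree α) (hi : i ≤ 1 + rank α) :
    rank (Added α i) = rank α + if srank α < i then 1 else 0 := by
  rcases le_or_gt i (srank α) with hs | hs
  · rw [if_neg (by omega), (level_rank_added_of_le_srank h hs).2.2, add_zero]
  rw [if_pos hs, add_comm]
  rcases le_or_gt i (rank α) with hr | hr
  · exact (level_rank_added_of_middle h hs hr).2.2
  obtain rfl : i = 1 + rank α := by omega
  exact (level_rank_added_top h).2.2

theorem removed_added_iso (h : IsFree α) (hi : i ≤ 1 + rank α) :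
    Nonempty (Removed (Added.new α i) ≃o α) := by
  rcases le_or_gt i (srank α) with hs | hs
  · exact removed_added_iso_of_le_srank h hs
  rcases le_or_gt i (rank α) with hr | hr
  · exact removed_added_iso_of_middle h hs hr
  obtain rfl : i = 1 + rank α := by omega
  exact removed_added_iso_top h

theorem isRemovable_new (h : IsFree α) (hi : i ≤ 1 + rank α) : IsRemovable (Added.new α i) := by
  refine ⟨Added.isMax_new, ?_⟩
  rw [srank_added_eq h hi]
  rcases le_or_gt i (srank α) with hs | hs
  · exact (level_rank_added_of_le_srank h hs).1
  rcases le_or_gt i (rank α) with hr | hr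
  · exact (level_rank_added_of_middle h hs hr).1
  obtain rfl : i = 1 + rank α := by omega
  exact (level_rank_added_top h).1

/-- Removal on isomorphism classes chooses an arbitrary removable element, not necessarily the new
one, so independence of that choice is needed here. -/
theorem removed_added_iso_of_isRemovable (h : IsFree α) (hi : i ≤ 1 + rank α)
    {x : Added α i} (hx : IsRemovable x) :
    Nonempty (Removed x ≃o α) := by
  obtain ⟨e⟩ := removed_iso_of_removable (h.added i) (OrderIso.refl _) hx (isRemovable_new h hi)
  obtain ⟨f⟩ := removed_added_iso h hi
  exact ⟨e.trans f⟩

end addition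

/-! ### Removal followed by addition -/

section removal

variable {α : Type*} [PartialOrder α] [Finite α]

/-- An element other than the removed one, seen in the poset after removal. -/
def Removed.mk {α : Type*} {x : α} (y : α) (h : y ≠ x) : Removed x := ⟨y, h⟩

theorem Removed.val_mk {α : Type*} {x y : α} (h : y ≠ x) : (Removed.mk y h).1 = y := rfl

/-- To recover a poset by addition after a removal it suffices to recover the strict down-set of
the removed element and the relations between the other elements. -/
theorem added_removed_iso_of {x : α} {i : ℕ} (hx : IsMax x)
    (hnew : ∀ a : Removed x, Added.old i a < Added.new (Removed x) i ↔ a.1 < x)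
    (hold : ∀ a b : Removed x, Added.old i a < Added.old i b ↔ a.1 < b.1) :
    Nonempty (Added (Removed x) i ≃o α) := by
  classical
  let e : Added (Removed x) i ≃ α := Equiv.optionSubtypeNe x
  have hen : e (Added.new _ i) = x := Equiv.optionSubtypeNe_none x
  have heo : ∀ a : Removed x, e (Added.old i a) = a.1 := fun a => Equiv.optionSubtypeNe_some x a
  refine nonempty_orderIso_of_lt_iff e fun a b => ?_
  rcases a.eq_new_or_old with rfl | ⟨a, rfl⟩
  · rw [hen]
    exact iff_of_false hx.not_lt (Added.not_new_lt b)
  rcases b.eq_new_or_old with rfl | ⟨b, rfl⟩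
  · rw [hen, heo, hnew]
  · rw [heo, heo, hold]

variable {x : α}

/-! ### Removal from a level with several elements -/

section many

/-- Since `x` is maximal, it lies in no down-set, and another element `z` still represents its
level. -/
theorem level_rank_removed_of_ncard_ne_one (h : IsFree α) (hx : IsRemovable x)
    (hc : (levelSet α (srank α)).ncard ≠ 1) :
    (∀ y : Removed x, level y = level y.1) ∧ rank (Removed x) = rank α := by
  have : Nonempty α := ⟨x⟩
  obtain ⟨z, hzx, hz⟩ := exists_ne_level_eq_of_ncard_ne_one hx.2 hc
  have hlt : ∀ a b : Removed x, a < b ↔ a.1 < b.1 := by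
    intro a b
    rw [Removed.lt_iff, and_iff_left (removalSet_eq_empty (fun hh => hc hh.1) _)]
  refine level_rank_of_labelling (f := fun y : Removed x => level y.1) ?_ ?_ ?_ ?_
  · intro u v a huv ha
    rw [hlt] at ha ⊢
    exact h.lt_of_lt_of_level_le ha huv
  · intro u v huv
    obtain ⟨a, ha, ha'⟩ := h.exists_lt_of_level_lt huv
    exact ⟨Removed.mk a (hx.ne_of_lt ha), (hlt _ _).2 ha, fun hh => ha' ((hlt _ _).1 hh)⟩
  · exact fun u => level_le_rank u.1
  · intro j hj
    obtain ⟨y, hy⟩ := h.exists_level_eq hj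
    by_cases hyx : y = x
    · subst hyx
      exact ⟨⟨z, hzx⟩, by rw [← hy, hx.2, hz]⟩
    · exact ⟨⟨y, hyx⟩, hy⟩

theorem added_removed_iso_of_ncard_ne_one (h : IsFree α) (hx : IsRemovable x)
    (hc : (levelSet α (srank α)).ncard ≠ 1) :
    srank α ≤ 1 + rank (Removed x) ∧ Nonempty (Added (Removed x) (srank α) ≃o α) := by
  have : Nonempty α := ⟨x⟩
  obtain ⟨h1, h2⟩ := level_rank_removed_of_ncard_ne_one h hx hc
  obtain ⟨z, hzx, hz⟩ := exists_ne_level_eq_of_ncard_ne_one hx.2 hc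
  have hlt : ∀ a b : Removed x, a < b ↔ a.1 < b.1 := by
    intro a b
    rw [Removed.lt_iff, and_iff_left (removalSet_eq_empty (fun hh => hc hh.1) _)]
  have hxz : level x = level z := hx.2.trans hz.symm
  have hzl : level (Removed.mk z hzx) = srank α := by rw [h1, Removed.val_mk, hz]
  have : Nonempty (Removed x) := ⟨⟨z, hzx⟩⟩
  -- An element maximal after the removal was maximal before: if it were below `x`, it would be
  -- below `z`, which has the same down-set. So the addition falls under the case that creates no
  -- relations.
  have hsr : srank α ≤ srank (Removed x) := by
    obtain ⟨m, hm, hml⟩ := exists_removable (α := Removed x)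
    rw [← hml, h1]
    refine srank_le_level (isMax_iff_forall_not_lt.2 fun b hb => ?_)
    by_cases hbx : b = x
    · subst hbx
      exact hm.not_lt (b := Removed.mk z hzx) ((hlt _ _).2 (h.lt_of_lt_of_level_le hb hxz.le))
    · exact hm.not_lt (b := Removed.mk b hbx) ((hlt _ _).2 hb)
  have hr := srank_le_rank (α := α)
  refine ⟨by omega, added_removed_iso_of hx.1 (fun a => ?_) fun a b => ?_⟩
  · rw [Added.old_lt_new, (h.removed x).mem_levelDown_iff hzl, hlt, or_iff_right (by omega)]
    exact ⟨fun ha => h.lt_of_lt_of_level_le ha hxz.ge, fun ha => h.lt_of_lt_of_level_le ha hxz.le⟩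
  · rw [Added.old_lt_old, or_iff_left (not_isCreated_of_le_srank hsr a b), hlt]

end many

/-! ### Removal of the only element of a level -/

section single

theorem added_removed_iso_of_srank_eq_rank (h : IsFree α) (hx : IsRemovable x)
    (hc : (levelSet α (srank α)).ncard = 1) [Nontrivial α] (hr : srank α = rank α) :
    srank α ≤ 1 + rank (Removed x) ∧ Nonempty (Added (Removed x) (srank α) ≃o α) := by
  -- Every maximal element has level between `srank` and `rank`, which agree, so it is `x`; hence
  -- `x` is the greatest element.
  have hall : ∀ y, y ≠ x → y < x := by
    intro y hy
    obtain ⟨z, hyz, hz⟩ := exists_isMax_ge y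
    have h1 := srank_le_level hz
    have h2 := level_le_rank z
    obtain rfl : z = x := hx.eq_of_level_eq hc (by omega)
    exact lt_of_le_of_ne hyz hy
  have hlt : ∀ a b : Removed x, a < b ↔ a.1 < b.1 := by
    intro a b
    rw [Removed.lt_iff, and_iff_left (removalSet_eq_empty (fun hh => by omega) _)]
  obtain ⟨y, hy⟩ := exists_ne x
  -- This makes `rank α - 1` a genuine predecessor, so that addition at level `srank α` is addition
  -- on top.
  have hpos : 0 < srank α := by
    have := level_lt (hall y hy)
    rw [hx.2] at this
    omega
  have key := level_rank_of_labelling (f := fun y : Removed x => level y.1) (k := rank α - 1)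
    ?_ ?_ ?_ ?_
  · have hk := key.2
    refine ⟨by omega, added_removed_iso_of hx.1 (fun a => ?_) fun a b => ?_⟩
    · rw [Added.old_lt_new]
      exact iff_of_true (Or.inl (by omega)) (hall _ a.2)
    · rw [Added.old_lt_old, or_iff_left (not_isCreated_of_rank_lt (by omega) a b), hlt]
  · intro u v a huv ha
    rw [hlt] at ha ⊢
    exact h.lt_of_lt_of_level_le ha huv
  · intro u v huv
    obtain ⟨a, ha, ha'⟩ := h.exists_lt_of_level_lt huv
    exact ⟨Removed.mk a (hx.ne_of_lt ha), (hlt _ _).2 ha, fun hh => ha' ((hlt _ _).1 hh)⟩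
  · intro u
    have := level_lt (hall u.1 u.2)
    rw [hx.2] at this
    omega
  · intro j hj
    obtain ⟨z, hz⟩ := h.exists_level_eq (j := j) (by omega)
    refine ⟨⟨z, ?_⟩, hz⟩
    rintro rfl
    have := hx.2
    omega

theorem mem_removalSet_iff (h : IsFree α) (hx : IsRemovable x)
    (hc : (levelSet α (srank α)).ncard = 1) (hr : srank α < rank α)
    {w : α} (hw : level w = srank α + 1) {a : α} :
    a ∈ removalSet α ↔ a < w ∧ ¬ a < x := by
  unfold removalSet
  simp only [Set.mem_ofPred_eq, Set.mem_sdiff, h.mem_levelDown_iff hw,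
    h.mem_levelDown_iff hx.2]
  exact and_iff_right ⟨hc, hr⟩

/-- With `i = srank`, deleting the relations that start in `D_{i+1} \ D_i` turns `D_{i+1}` into
`D_i` and leaves the smaller down-sets alone. Level `i` loses its only element, and the levels above
it drop by one. -/
theorem level_rank_removed_of_srank_lt_rank (h : IsFree α) (hx : IsRemovable x)
    (hc : (levelSet α (srank α)).ncard = 1) (hr : srank α < rank α) :
    (∀ y : Removed x, level y = if level y.1 < srank α then level y.1 else level y.1 - 1) ∧
      rank (Removed x) = rank α - 1 := by
  have : Nonempty α := ⟨x⟩
  obtain ⟨w, hw⟩ := h.exists_level_eq (j := srank α + 1) hr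
  have hN := @mem_removalSet_iff _ _ _ _ h hx hc hr _ hw
  have hne : ∀ y : Removed x, level y.1 ≠ srank α := fun y hy => y.2 (hx.eq_of_level_eq hc hy)
  have hxl := hx.2
  refine level_rank_of_labelling
    (f := fun y : Removed x => if level y.1 < srank α then level y.1 else level y.1 - 1)
    ?_ ?_ ?_ ?_
  · intro u v a huv ha
    have hu := hne u
    have hv := hne v
    rw [Removed.lt_iff, hN] at ha ⊢
    refine ⟨?_, ha.2⟩
    by_cases huv' : level u.1 ≤ level v.1
    · exact h.lt_of_lt_of_level_le ha.1 huv'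
    · grind
  · intro u v huv
    have hu := hne u
    have hv := hne v
    have huv' : level u.1 < level v.1 := by grind
    by_cases hus : level u.1 < srank α
    · obtain ⟨a, ha, ha'⟩ := h.exists_lt_of_level_lt (u := u.1)
        (v := if level v.1 < srank α then v.1 else x) (by grind)
      have hax : a < x := h.lt_of_lt_of_level_le ha (by grind)
      have hav : a < v.1 := h.lt_of_lt_of_level_le ha (by grind)
      refine ⟨Removed.mk a (hx.ne_of_lt ha), ?_, fun hh => ha' ((Removed.lt_iff _ _).1 hh).1⟩
      rw [Removed.lt_iff, hN, Removed.val_mk]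
      exact ⟨hav, fun hh => hh.2 hax⟩
    · obtain ⟨a, ha, ha'⟩ := h.exists_lt_of_level_lt huv'
      refine ⟨Removed.mk a (hx.ne_of_lt ha), ?_, fun hh => ha' ((Removed.lt_iff _ _).1 hh).1⟩
      rw [Removed.lt_iff, hN, Removed.val_mk]
      -- Here `u` lies above level `srank`, so an element below `w` would already be below `u`.
      exact ⟨ha, fun hh => ha' (h.lt_of_lt_of_level_le hh.1 (by omega))⟩
  · intro u
    have := level_le_rank u.1
    grind
  · intro j hj
    by_cases hjs : j < srank α
    · obtain ⟨y, hy⟩ := h.exists_level_eq (j := j) (by omega)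
      refine ⟨⟨y, ?_⟩, ?_⟩
      · rintro rfl
        omega
      · simp only [hy, if_pos hjs]
    · obtain ⟨y, hy⟩ := h.exists_level_eq (j := j + 1) (by omega)
      refine ⟨⟨y, ?_⟩, ?_⟩
      · rintro rfl
        omega
      · simp only [hy]
        grind

/-- The elements of the removal set become exactly the maximal elements of original level less than
`srank α`, so the addition recreates precisely the deleted relations. -/
theorem added_removed_iso_of_srank_lt_rank (h : IsFree α) (hx : IsRemovable x)
    (hc : (levelSet α (srank α)).ncard = 1) (hr : srank α < rank α) :
    srank α ≤ 1 + rank (Removed x) ∧ Nonempty (Added (Removed x) (srank α) ≃o α) := by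
  have : Nonempty α := ⟨x⟩
  obtain ⟨w, hw⟩ := h.exists_level_eq (j := srank α + 1) hr
  have hN := @mem_removalSet_iff _ _ _ _ h hx hc hr _ hw
  obtain ⟨h1, h2⟩ := level_rank_removed_of_srank_lt_rank h hx hc hr
  have hxl := hx.2
  have hwx : w ≠ x := by
    rintro rfl
    omega
  have hwl : level (Removed.mk w hwx) = srank α := by rw [h1, Removed.val_mk]; grind
  have hfree := h.removed x
  have hxw : ∀ {a : α}, a < x → a < w := fun ha => h.lt_of_lt_of_level_le ha (by omega)
  have hNlevel : ∀ a ∈ removalSet α, level a < srank α := by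
    intro a ha
    have h3 := level_lt (hN.1 ha).1
    have h4 : level a ≠ srank α := fun h4 =>
      hx.ne_of_lt (hN.1 ha).1 (hx.eq_of_level_eq hc h4)
    omega
  have hNmax : ∀ a : Removed x, a.1 ∈ removalSet α → IsMax a := fun a ha =>
    isMax_iff_forall_not_lt.2 fun b hb => ((Removed.lt_iff _ _).1 hb).2 ha
  -- An element of level less than `srank` is not maximal in `α`. Outside the removal set its
  -- relations survive, and a relation to `x` can be replaced by one to `w`.
  have hmaxN : ∀ a : Removed x, IsMax a → level a.1 < srank α → a.1 ∈ removalSet α := by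
    intro a ha hal
    by_contra hcon
    have hmax : ¬ IsMax a.1 := fun hm => absurd (srank_le_level hm) (by omega)
    obtain ⟨b, hb⟩ := not_isMax_iff.1 hmax
    by_cases hbx : b = x
    · subst hbx
      exact ha.not_lt (b := Removed.mk w hwx) ((Removed.lt_iff _ _).2 ⟨hxw hb, hcon⟩)
    · exact ha.not_lt (b := Removed.mk b hbx) ((Removed.lt_iff _ _).2 ⟨hb, hcon⟩)
  -- The removal set is nonempty because `x` and `w` have different down-sets, and its elements are
  -- now maximal of low level.
  have hsr : srank (Removed x) < srank α := by
    obtain ⟨a, ha, ha'⟩ := h.exists_lt_of_level_lt (u := x) (v := w) (by omega)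
    have haN := hN.2 ⟨ha, ha'⟩
    have hal := hNlevel a haN
    have h3 := srank_le_level (hNmax (Removed.mk a (hx.ne_of_lt ha)) haN)
    rw [h1, Removed.val_mk, if_pos hal] at h3
    omega
  refine ⟨by omega, added_removed_iso_of hx.1 (fun a => ?_) fun a b => ?_⟩
  · rw [Added.old_lt_new, hfree.mem_levelDown_iff hwl, Removed.lt_iff, hN,
      or_iff_right (by omega)]
    constructor
    · rintro ⟨h3, h4⟩
      by_contra hcon
      exact h4 ⟨h3, hcon⟩
    · exact fun h3 => ⟨hxw h3, fun hh => hh.2 h3⟩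
  · have hb : level b.1 ≠ srank α := fun hb => b.2 (hx.eq_of_level_eq hc hb)
    rw [old_lt_old_of_middle hfree hsr (by omega), Removed.lt_iff, h1, h1]
    constructor
    · rintro (hab | ⟨h3, h4, h5⟩)
      · exact hab.1
      -- The shifted inequality alone would permit original level `srank α`; this is excluded
      -- because only `x` lies there.
      · have haN := hmaxN a h4 (by grind [fun ha : level a.1 = srank α => a.2 (hx.eq_of_level_eq hc ha)])
        exact h.lt_of_lt_of_level_le (hN.1 haN).1 (by grind)
    · intro hab
      by_cases haN : a.1 ∈ removalSet α
      · have hal := hNlevel _ haN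
        -- Otherwise `a` would lie below `x`, contrary to its membership in the removal set.
        have hbl : ¬ level b.1 ≤ srank α := fun hbl =>
          (hN.1 haN).2 (h.lt_of_lt_of_level_le hab (by omega))
        exact Or.inr ⟨by grind, hNmax a haN, by grind⟩
      · exact Or.inl ⟨hab, haN⟩

end single

theorem added_removed_iso (h : IsFree α) (hx : IsRemovable x) [Nontrivial α] :
    srank α ≤ 1 + rank (Removed x) ∧ Nonempty (Added (Removed x) (srank α) ≃o α) := by
  have : Nonempty α := ⟨x⟩
  by_cases hc : (levelSet α (srank α)).ncard = 1
  · rcases (srank_le_rank (α := α)).eq_or_lt with hr | hr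
    · exact added_removed_iso_of_srank_eq_rank h hx hc hr
    · exact added_removed_iso_of_srank_lt_rank h hx hc hr
  · exact added_removed_iso_of_ncard_ne_one h hx hc

end removal

/-! ### Ascents and extension of sequences -/

section sequences

variable {n : ℕ}

theorem asc_eq_sum (x : Fin (n + 1) → ℕ) :
    asc x = ∑ j : Fin n, if x j.castSucc < x j.succ then 1 else 0 := by
  rw [← Finset.card_filter]
  have : {j : Fin (n + 1) | ∃ h : (j : ℕ) + 1 < n + 1, x j < x ⟨(j : ℕ) + 1, h⟩} =
      Fin.castSucc '' ((Finset.univ.filter fun j : Fin n => x j.castSucc < x j.succ : Finset _) :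
        Set (Fin n)) := by
    ext j
    constructor
    · rintro ⟨h, hj⟩
      refine ⟨⟨j, by omega⟩, ?_, rfl⟩
      simpa using hj
    · rintro ⟨k, hk, rfl⟩
      refine ⟨by simp, ?_⟩
      exact (Finset.mem_filter.1 hk).2
  rw [asc, this, Set.ncard_image_of_injective _ (Fin.castSucc_injective n), Set.ncard_coe_finset]

theorem asc_snoc (x : Fin (n + 1) → ℕ) (i : ℕ) :
    asc (Fin.snoc (α := fun _ => ℕ) x i) = asc x + if x (Fin.last n) < i then 1 else 0 := by
  rw [asc_eq_sum, asc_eq_sum, Fin.sum_univ_castSucc]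
  congr 1
  · refine Finset.sum_congr rfl fun j _ => ?_
    rw [← Fin.castSucc_succ, Fin.snoc_castSucc, Fin.snoc_castSucc]
  · rw [Fin.snoc_castSucc, Fin.succ_last, Fin.snoc_last]

/-- The condition at a position involves only that entry and the earlier ones, so appending an entry
adds a single condition, in which the initial segment is all of `x`. -/
theorem isAscentSeq_snoc (x : Fin (n + 1) → ℕ) (i : ℕ) :
    IsAscentSeq (Fin.snoc (α := fun _ => ℕ) x i) ↔ IsAscentSeq x ∧ i ≤ 1 + asc x := by
  have h0 : (Fin.snoc (α := fun _ => ℕ) x i : Fin (n + 2) → ℕ) ⟨0, Nat.succ_pos _⟩ =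
      x ⟨0, Nat.succ_pos _⟩ := Fin.snoc_castSucc (α := fun _ => ℕ) i x ⟨0, Nat.succ_pos _⟩
  have h1 : ∀ j : Fin (n + 1),
      initSeg (Fin.snoc (α := fun _ => ℕ) x i : Fin (n + 2) → ℕ) j.castSucc = initSeg x j :=
    fun j => funext fun k =>
      Fin.snoc_castSucc (α := fun _ => ℕ) i x (Fin.castLE j.isLt.le k)
  have h2 : initSeg (Fin.snoc (α := fun _ => ℕ) x i : Fin (n + 2) → ℕ) (Fin.last (n + 1)) = x :=
    funext fun k => Fin.snoc_castSucc (α := fun _ => ℕ) i x k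
  unfold IsAscentSeq
  rw [Fin.forall_fin_succ', Fin.snoc_last, h2]
  simp only [h0, h1, Fin.snoc_castSucc]
  constructor
  · rintro ⟨ha, hb, hc⟩
    exact ⟨⟨fun _ => ha (Nat.succ_pos _), hb⟩, hc (Nat.succ_pos _)⟩
  · rintro ⟨⟨ha, hb⟩, hc⟩
    exact ⟨fun _ => ha (Nat.succ_pos _), hb, fun _ => hc⟩

theorem isAscentSeq_one_iff (x : Fin 1 → ℕ) : IsAscentSeq x ↔ x = fun _ => 0 := by
  constructor
  · intro h
    funext j
    rw [Subsingleton.elim j ⟨0, Nat.one_pos⟩]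
    exact h.1 Nat.one_pos
  · rintro rfl
    exact ⟨fun _ => rfl, fun _ _ => Nat.zero_le _⟩

end sequences

/-! ### Isomorphism classes and the induction -/

section unlabeled

variable {n : ℕ}

theorem FreePoset.nonempty_carrier (P : FreePoset (n + 1)) : Nonempty P.carrier :=
  let ⟨x, _⟩ := P.exists_removable
  ⟨x⟩

theorem FreePoset.nontrivial_carrier (P : FreePoset (n + 2)) : Nontrivial P.carrier := by
  rw [← Finite.one_lt_card_iff_nontrivial, P.card_eq]
  omega

theorem FreePoset.subsingleton_carrier (P : FreePoset 1) : Subsingleton P.carrier :=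
  (Nat.card_eq_one_iff_unique.1 P.card_eq).1

theorem UPoset.srank_add (Q : UPoset (n + 1)) {i : ℕ} (hi : i ≤ 1 + Q.rank) :
    (Q.add i).srank = i := by
  induction Q using Quotient.inductionOn with
  | h Q =>
    have := Q.nonempty_carrier
    exact srank_added_eq Q.free hi

theorem UPoset.rank_add (Q : UPoset (n + 1)) {i : ℕ} (hi : i ≤ 1 + Q.rank) :
    (Q.add i).rank = Q.rank + if Q.srank < i then 1 else 0 := by
  induction Q using Quotient.inductionOn with
  | h Q =>
    have := Q.nonempty_carrier
    exact rank_added_eq Q.free hi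

theorem UPoset.remove_add (Q : UPoset (n + 1)) {i : ℕ} (hi : i ≤ 1 + Q.rank) :
    (Q.add i).remove = Q := by
  induction Q using Quotient.inductionOn with
  | h Q =>
    have := Q.nonempty_carrier
    exact Quotient.sound
      (removed_added_iso_of_isRemovable Q.free hi (Q.add i).exists_removable.choose_spec)

theorem UPoset.srank_le_and_add_remove (P : UPoset (n + 2)) :
    P.srank ≤ 1 + P.remove.rank ∧ P.remove.add P.srank = P := by
  induction P using Quotient.inductionOn with
  | h P =>
    have := P.nontrivial_carrier
    obtain ⟨h1, h2⟩ := added_removed_iso P.free P.exists_removable.choose_spec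
    exact ⟨h1, Quotient.sound h2⟩

theorem UPoset.rank_eq_zero_and_srank_eq_zero (P : UPoset 1) : P.rank = 0 ∧ P.srank = 0 := by
  induction P using Quotient.inductionOn with
  | h P =>
    have := P.nonempty_carrier
    have := P.subsingleton_carrier
    have hr : TwoPlusTwo.rank P.carrier = 0 := by
      rw [TwoPlusTwo.rank, downsets, Set.range_eq_singleton (y := ∅), Set.ncard_singleton]
      intro x
      exact Set.eq_empty_of_forall_notMem fun y hy => hy.ne (Subsingleton.elim y x)
    have hs : TwoPlusTwo.srank P.carrier ≤ TwoPlusTwo.rank P.carrier := srank_le_rank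
    exact ⟨hr, Nat.le_zero.1 (hs.trans hr.le)⟩

theorem UPoset.eq_of_one (P Q : UPoset 1) : P = Q := by
  induction P, Q using Quotient.inductionOn₂ with
  | h P Q =>
    have := P.subsingleton_carrier
    have := Q.subsingleton_carrier
    obtain ⟨p⟩ := P.nonempty_carrier
    obtain ⟨q⟩ := Q.nonempty_carrier
    refine Quotient.sound (nonempty_orderIso_of_lt_iff
      ⟨fun _ => q, fun _ => p, fun _ => Subsingleton.elim _ _, fun _ => Subsingleton.elim _ _⟩ ?_)
    intro a b
    exact iff_of_false (lt_irrefl _) fun h => h.ne (Subsingleton.elim _ _)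

/-- The one-element poset. -/
def UPoset.one : UPoset 1 :=
  Quotient.mk _ ⟨Unit, Nat.card_unique,
    ⟨fun f => by simpa using f.injective (Subsingleton.elim (f (Sum.inl 0)) (f (Sum.inr 0)))⟩⟩

theorem Psi_succ (P : UPoset (n + 2)) :
    Psi (n + 1) P = Fin.snoc (α := fun _ => ℕ) (Psi n P.remove) P.srank := rfl

theorem Psi_add (Q : UPoset (n + 1)) {i : ℕ} (hi : i ≤ 1 + Q.rank) :
    Psi (n + 1) (Q.add i) = Fin.snoc (α := fun _ => ℕ) (Psi n Q) i := by
  rw [Psi_succ, Q.remove_add hi, Q.srank_add hi]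

theorem srank_eq_Psi_last : ∀ {n : ℕ} (P : UPoset (n + 1)), P.srank = Psi n P (Fin.last n)
  | 0, P => P.rank_eq_zero_and_srank_eq_zero.2
  | n + 1, P => by rw [Psi_succ, Fin.snoc_last]

/-- Writing the poset as an addition to its own removal, the recursions for `rank` and `asc` have
the same increment. -/
theorem rank_eq_asc_Psi (P : UPoset (n + 1)) : P.rank = asc (Psi n P) := by
  induction n with
  | zero => rw [P.rank_eq_zero_and_srank_eq_zero.1, asc_eq_sum, Finset.univ_eq_empty,
      Finset.sum_empty]
  | succ n ih =>
    obtain ⟨h1, h2⟩ := P.srank_le_and_add_remove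
    rw [Psi_succ, asc_snoc, ← ih, ← srank_eq_Psi_last, ← UPoset.rank_add _ h1, h2]

theorem isAscentSeq_Psi (P : UPoset (n + 1)) : IsAscentSeq (Psi n P) := by
  induction n with
  | zero => exact (isAscentSeq_one_iff _).2 rfl
  | succ n ih =>
    rw [Psi_succ, isAscentSeq_snoc, ← rank_eq_asc_Psi]
    exact ⟨ih _, P.srank_le_and_add_remove.1⟩

/-- The last entry and the preceding ones determine `srank` and, by induction, the removal; addition
rebuilds the poset from these. -/
theorem Psi_injective (n : ℕ) : Function.Injective (Psi n) := by
  induction n with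
  | zero => exact fun P Q _ => P.eq_of_one Q
  | succ n ih =>
    intro P Q h
    rw [Psi_succ, Psi_succ, Fin.snoc_inj] at h
    rw [← P.srank_le_and_add_remove.2, ← Q.srank_le_and_add_remove.2, ih h.1, h.2]

theorem exists_Psi_eq {x : Fin (n + 1) → ℕ} (hx : IsAscentSeq x) : ∃ P, Psi n P = x := by
  induction n with
  | zero => exact ⟨UPoset.one, ((isAscentSeq_one_iff x).1 hx).symm⟩
  | succ n ih =>
    induction x using Fin.snocCases with
    | snoc x i =>
      rw [isAscentSeq_snoc] at hx
      obtain ⟨Q, rfl⟩ := ih hx.1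
      rw [← rank_eq_asc_Psi] at hx
      exact ⟨Q.add i, Psi_add Q hx.2⟩

end unlabeled

end TwoPlusTwo

theorem theorem3p4 (n : ℕ) :
    Set.BijOn (TwoPlusTwo.Psi n) Set.univ
        {x : Fin (n + 1) → ℕ | TwoPlusTwo.IsAscentSeq x} ∧
      (∀ P : TwoPlusTwo.UPoset (n + 1),
        P.rank = TwoPlusTwo.asc (TwoPlusTwo.Psi n P) ∧
          P.srank = TwoPlusTwo.Psi n P (Fin.last n)) ∧
      (∀ (Q : TwoPlusTwo.UPoset (n + 1)) (i : ℕ), i ≤ 1 + Q.rank →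
        TwoPlusTwo.Psi (n + 1) (Q.add i) =
          Fin.snoc (α := fun _ => ℕ) (TwoPlusTwo.Psi n Q) i) := by
  open TwoPlusTwo in
  exact ⟨⟨fun P _ => isAscentSeq_Psi P, (Psi_injective n).injOn,
      fun _ hx => let ⟨P, hP⟩ := exists_Psi_eq hx; ⟨P, Set.mem_univ P, hP⟩⟩,
    fun P => ⟨rank_eq_asc_Psi P, srank_eq_Psi_last P⟩, fun Q _ hi => Psi_add Q hi⟩
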